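/- **Theorem 4.4.** Let $\mathbb{R}^2\times S^1$ carry the flat product metric $g_{\mathbb{R}^2}\times g_{S^1}$, where $S^1\subset\mathbb{R}^2$ is the unit circle; equivalently, the metric induced by the inclusion $\mathbb{R}^2\times S^1\subset\mathbb{R}^2\times\mathbb{R}^2=\mathbb{R}^4$. Let $T^2=S^1\times S^1$ be the smooth 2-torus. For a smooth immersion $x:T^2\to\mathbb{R}^2\times S^1$ with induced metric $g=x^*(g_{\mathbb{R}^2}\times g_{S^1})$, area element $dM$, second fundamental form $II$, $S=|II|^2$ and mean curvature vector $\vec H=\tfrac12\operatorname{tr}_g II$, the Willmore functional is $$W(x)=\frac12\int_{T^2}\bigl(S-2|\vec H|^2\bigr)\,dM=\frac12\int_{T^2}|II-\vec H g|^2\,dM .$$ (i) Every smooth immersion $x:T^2\to\mathbb{R}^2\times S^1$ satisfies $W(x)>0$. (ii) For every real $t>0$ the map $x_t(u,v)=(t\cos u,t\sin u,\cos v,\sin v)$, $u,v\in\mathbb{R}/2\pi\mathbb{Z}$, is a smooth immersion $T^2\to\mathbb{R}^2\times S^1$ with $W(x_t)=\pi^2/t$; in particular $W(x_t)\to 0$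 as $t\to\infty$. Hence no torus attains the least Willmore functional: there is no smooth immersion $x:T^2\to\mathbb{R}^2\times S^1$ such that $W(x)\le W(x')$ for every smooth immersion $x':T^2\to\mathbb{R}^2\times S^1$. -/

import Mathlib

open scoped Manifold ContDiff

noncomputable section

namespace WillmoreTorus

/-- The Euclidean plane. -/
abbrev Plane : Type := EuclideanSpace ℝ (Fin 2)

/-- The abstract smooth 2-torus `T² = S¹ × S¹`. -/
abbrev Torus : Type := Circle × Circle

/-- The smooth manifold `ℝ² × S¹`. -/
abbrev PlaneCircle : Type := Plane × Circle

/-- The standard inclusion `ℝ² × S¹ ⊆ ℝ² × ℝ² = ℝ⁴`, with `S¹` the unit circle. The product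
metric `g_{ℝ²} × g_{S¹}` is the metric that it induces from `ℝ⁴`. -/
def incl (y : PlaneCircle) : EuclideanSpace ℝ (Fin 4) :=
  !₂[y.1 0, y.1 1, (y.2 : ℂ).re, (y.2 : ℂ).im]

/-- The tangent space of `ℝ² × S¹` at the point `y`, as a subspace of `ℝ⁴`: the vectors that are
orthogonal to the radial vector `(0, 0, y₂, y₃)` of the circle. -/
def tangentAt (y : EuclideanSpace ℝ (Fin 4)) : Submodule ℝ (EuclideanSpace ℝ (Fin 4)) :=
  (ℝ ∙ (!₂[0, 0, y 2, y 3] : EuclideanSpace ℝ (Fin 4)))ᗮ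

/-- `f : T² → ℝ² × S¹` is a (smooth) immersion: it is `C^∞` and its differential is injective at
every point. -/
def IsImmersedTorus (f : Torus → PlaneCircle) : Prop :=
  ContMDiff ((𝓡 1).prod (𝓡 1)) (𝓘(ℝ, Plane).prod (𝓡 1)) ∞ f ∧
    ∀ p : Torus,
      Function.Injective (mfderiv ((𝓡 1).prod (𝓡 1)) (𝓘(ℝ, Plane).prod (𝓡 1)) f p)

section Surface

/-! Extrinsic geometry of a parametrized surface `X : ℝ² → N` in a submanifold `N` of a Euclidean
space `E` with the induced metric; `TN y ⊆ E` is the tangent space of `N` at `y`. -/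

variable {E : Type*} [NormedAddCommGroup E] [InnerProductSpace ℝ E] [FiniteDimensional ℝ E]

/-- The coordinate vectors of the parameter plane. -/
def coordVec : Fin 2 → ℝ × ℝ := ![(1, 0), (0, 1)]

/-- The partial derivative `∂ᵢ X`. -/
def partialDeriv (i : Fin 2) (X : ℝ × ℝ → E) (p : ℝ × ℝ) : E :=
  fderiv ℝ X p (coordVec i)

/-- The first fundamental form `gᵢⱼ = ⟨∂ᵢ X, ∂ⱼ X⟩`. -/
def firstForm (X : ℝ × ℝ → E) (p : ℝ × ℝ) : Matrix (Fin 2) (Fin 2) ℝ :=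
  Matrix.of fun i j => inner ℝ (partialDeriv i X p) (partialDeriv j X p)

/-- The normal space of the surface in `N`: the vectors tangent to `N` and orthogonal to `∂₁ X`
and `∂₂ X`. -/
def normalSpace (TN : E → Submodule ℝ E) (X : ℝ × ℝ → E) (p : ℝ × ℝ) : Submodule ℝ E :=
  TN (X p) ⊓ (Submodule.span ℝ (Set.range fun i => partialDeriv i X p))ᗮ

/-- The second fundamental form of the surface in `N`: `IIᵢⱼ` is the component of
`∇_{∂ᵢ X} ∂ⱼ X` in the normal space of the surface in `N`, for the Levi-Civita connection `∇` of
`N`. As `∇` is the tangential part of the derivative in `E`, this is the orthogonal projection of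
`∂ᵢ ∂ⱼ X` to the normal space. -/
def secondForm (TN : E → Submodule ℝ E) (X : ℝ × ℝ → E) (p : ℝ × ℝ) (i j : Fin 2) : E :=
  (normalSpace TN X p).starProjection (partialDeriv i (partialDeriv j X) p)

/-- The mean curvature vector `H = (1/2) ∑ gⁱʲ IIᵢⱼ`. -/
def meanCurvature (TN : E → Submodule ℝ E) (X : ℝ × ℝ → E) (p : ℝ × ℝ) : E :=
  (1 / 2 : ℝ) • ∑ i, ∑ j, (firstForm X p)⁻¹ i j • secondForm TN X p i j

/-- The squared norm `S = |II|² = ∑ gⁱᵏ gʲˡ ⟨IIᵢⱼ, IIₖₗ⟩` of the second fundamental form. -/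
def secondFormNormSq (TN : E → Submodule ℝ E) (X : ℝ × ℝ → E) (p : ℝ × ℝ) : ℝ :=
  ∑ i, ∑ j, ∑ k, ∑ l, (firstForm X p)⁻¹ i k * (firstForm X p)⁻¹ j l *
    inner ℝ (secondForm TN X p i j) (secondForm TN X p k l)

/-- `ρ² = S - 2 |H|² = |II - H I|²`, the squared norm of the trace-free second fundamental form. -/
def rhoSq (TN : E → Submodule ℝ E) (X : ℝ × ℝ → E) (p : ℝ × ℝ) : ℝ :=
  secondFormNormSq TN X p - 2 * ‖meanCurvature TN X p‖ ^ 2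

/-- The density `√(det g)` of the area element `dM` with respect to `du dv`. -/
def areaDensity (X : ℝ × ℝ → E) (p : ℝ × ℝ) : ℝ :=
  Real.sqrt (firstForm X p).det

end Surface

/-- The map `f : T² → ℝ² × S¹` in the angular coordinates `(u, v) ↦ (e^{iu}, e^{iv})` of the
torus, as a map to `ℝ⁴`. -/
def lift (f : Torus → PlaneCircle) (p : ℝ × ℝ) : EuclideanSpace ℝ (Fin 4) :=
  incl (f (Circle.exp p.1, Circle.exp p.2))

/-- The Willmore functional `W(f) = (1/2) ∫_{T²} ρ² dM = (1/2) ∫_{T²} (S - 2 |H|²) dM` of a torus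
in `ℝ² × S¹`. The square `[0, 2π]²` is a fundamental domain for the angular coordinates. -/
def willmore (f : Torus → PlaneCircle) : ℝ :=
  (1 / 2) * ∫ p in Set.Icc (0 : ℝ) (2 * Real.pi) ×ˢ Set.Icc (0 : ℝ) (2 * Real.pi),
    rhoSq tangentAt (lift f) p * areaDensity (lift f) p

/-- The torus `x_t`, which is `(t cos u, t sin u, cos v, sin v)` at the point with angular
coordinates `(u, v)`. -/
def cylinderTorus (t : ℝ) (p : Torus) : PlaneCircle :=
  (!₂[t * (p.1 : ℂ).re, t * (p.1 : ℂ).im], p.2)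

end WillmoreTorus

end

/-!
The tori `x_t` have energy `π² / t`, which tends to `0`, so everything follows once an immersed
torus is known to have positive energy.

`ℝ² × S¹` is flat with a parallel orthonormal frame of its tangent spaces in `ℝ⁴`. In this frame
(`frame`, `coframe`) the derivatives `∂ᵢ X` of a parametrized surface become vector fields `Aᵢ` in
`ℝ³` with `∂ᵢ Aⱼ = ∂ⱼ Aᵢ`, and differentiating them is covariant differentiation
(`IsTorusChart.partialDeriv_flatDeriv`). So the surface has a normal `A₁ × A₂` and a scalar second
fundamental form `L`, and `ρ²` is, up to a positive factor, the discriminant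
`(g₂₂ L₁₁ - 2 g₁₂ L₁₂ + g₁₁ L₂₂)² - 4 det(g) det(L)` (`IsTorusChart.rhoSq_eq`), which is
nonnegative and vanishes exactly where `L` is a multiple of `g`. It is continuous and doubly
periodic, so a torus of zero energy is umbilic everywhere.

Then `det L ≥ 0`. The Gram–Schmidt frame `e₁, e₂` of `A₁, A₂` is defined on the whole torus, and the
curl of its connection form `⟨d e₁, e₂⟩` is a positive multiple of `det L` by the Gauss equation
(`curl_connection`). Its integral over the torus is zero by the divergence theorem. Hence
`det L = 0`, and with umbilicity `L = 0` (`IsTorusChart.normalCoeff_eq_zero`).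

Finally `L = 0` makes the unit normal `e₁ × e₂` constant. Some horizontal vector `w ≠ 0` is
orthogonal to it. At a maximum on the torus of the linear function `⟨w, ·⟩` of the `ℝ²`-component,
`w` is also orthogonal to `A₁` and `A₂`, so that `w = 0`, a contradiction
(`IsTorusChart.exists_normalCoeff_ne_zero`).
-/

open scoped Manifold ContDiff

noncomputable section

namespace WillmoreTorus

/-! ### Partial derivatives -/

section Calculus

variable {E : Type*} [NormedAddCommGroup E] [InnerProductSpace ℝ E]

theorem contDiff_partialDeriv {X : ℝ × ℝ → E} (hX : ContDiff ℝ ∞ X) (i : Fin 2) :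
    ContDiff ℝ ∞ (partialDeriv i X) :=
  (hX.fderiv_right (m := ∞) (by simp)).clm_apply contDiff_const

theorem differentiable_of_smooth {X : ℝ × ℝ → E} (hX : ContDiff ℝ ∞ X) : Differentiable ℝ X :=
  hX.differentiable (by simp)

theorem partialDeriv_comm {X : ℝ × ℝ → E} (hX : ContDiff ℝ ∞ X) (i j : Fin 2) (p : ℝ × ℝ) :
    partialDeriv i (partialDeriv j X) p = partialDeriv j (partialDeriv i X) p := by
  have hd : DifferentiableAt ℝ (fderiv ℝ X) p :=
    (hX.fderiv_right (m := ∞) (by simp)).differentiable (by simp) p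
  have key (k l : Fin 2) : partialDeriv k (partialDeriv l X) p
      = fderiv ℝ (fderiv ℝ X) p (coordVec k) (coordVec l) := by
    unfold partialDeriv
    rw [fderiv_clm_apply hd (differentiableAt_const _)]
    simp
  rw [key, key]
  exact (hX.contDiffAt.isSymmSndFDerivAt (by simpa using ENat.LEInfty.out)).eq _ _

theorem partialDeriv_inner {X Y : ℝ × ℝ → E} (hX : ContDiff ℝ ∞ X) (hY : ContDiff ℝ ∞ Y)
    (i : Fin 2) (p : ℝ × ℝ) :
    partialDeriv i (fun q => inner ℝ (X q) (Y q)) p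
      = inner ℝ (X p) (partialDeriv i Y p) + inner ℝ (partialDeriv i X p) (Y p) :=
  fderiv_inner_apply ℝ (differentiable_of_smooth hX p) (differentiable_of_smooth hY p) _

theorem partialDeriv_smul {c : ℝ × ℝ → ℝ} {X : ℝ × ℝ → E} (hc : ContDiff ℝ ∞ c)
    (hX : ContDiff ℝ ∞ X) (i : Fin 2) (p : ℝ × ℝ) :
    partialDeriv i (fun q => c q • X q) p
      = c p • partialDeriv i X p + partialDeriv i c p • X p := by
  unfold partialDeriv
  rw [fderiv_fun_smul (differentiable_of_smooth hc p) (differentiable_of_smooth hX p)]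
  simp

theorem partialDeriv_add {X Y : ℝ × ℝ → E} (hX : ContDiff ℝ ∞ X) (hY : ContDiff ℝ ∞ Y)
    (i : Fin 2) (p : ℝ × ℝ) :
    partialDeriv i (fun q => X q + Y q) p = partialDeriv i X p + partialDeriv i Y p := by
  unfold partialDeriv
  rw [fderiv_fun_add (differentiable_of_smooth hX p) (differentiable_of_smooth hY p)]
  simp

theorem partialDeriv_sub {X Y : ℝ × ℝ → E} (hX : ContDiff ℝ ∞ X) (hY : ContDiff ℝ ∞ Y)
    (i : Fin 2) (p : ℝ × ℝ) :
    partialDeriv i (fun q => X q - Y q) p = partialDeriv i X p - partialDeriv i Y p := by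
  unfold partialDeriv
  rw [fderiv_fun_sub (differentiable_of_smooth hX p) (differentiable_of_smooth hY p)]
  simp

theorem partialDeriv_mul {f g : ℝ × ℝ → ℝ} (hf : ContDiff ℝ ∞ f) (hg : ContDiff ℝ ∞ g)
    (i : Fin 2) (p : ℝ × ℝ) :
    partialDeriv i (fun q => f q * g q) p
      = f p * partialDeriv i g p + partialDeriv i f p * g p := by
  have := partialDeriv_smul hf hg i p
  simpa using this

theorem partialDeriv_const (c : E) (i : Fin 2) (p : ℝ × ℝ) :
    partialDeriv i (fun _ => c) p = 0 := by
  simp [partialDeriv]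

theorem smooth_coord {n : ℕ} {X : ℝ × ℝ → EuclideanSpace ℝ (Fin n)} (hX : ContDiff ℝ ∞ X)
    (k : Fin n) : ContDiff ℝ ∞ (fun q => X q k) :=
  contDiff_euclidean.1 hX k

theorem partialDeriv_coord {n : ℕ} {X : ℝ × ℝ → EuclideanSpace ℝ (Fin n)}
    (hX : ContDiff ℝ ∞ X) (i : Fin 2) (p : ℝ × ℝ) (k : Fin n) :
    partialDeriv i X p k = partialDeriv i (fun q => X q k) p := by
  unfold partialDeriv
  have h := (EuclideanSpace.proj k : EuclideanSpace ℝ (Fin n) →L[ℝ] ℝ).hasFDerivAt.comp p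
    (differentiable_of_smooth hX p).hasFDerivAt
  have h2 : HasFDerivAt (fun q => X q k) _ p := h
  rw [h2.fderiv]
  rfl

theorem fderiv_eq_zero_of_partialDeriv {X : ℝ × ℝ → E} {p : ℝ × ℝ}
    (h : ∀ i, partialDeriv i X p = 0) : fderiv ℝ X p = 0 := by
  ext
  · simpa [partialDeriv, coordVec] using h 0
  · simpa [partialDeriv, coordVec] using h 1

end Calculus

/-! ### Doubly periodic functions -/

/-- `φ` is `2π`-periodic in each of its two variables, that is, it comes from a function on the
torus in angular coordinates. -/
def DoublyPeriodic {α : Type*} (φ : ℝ × ℝ → α) : Prop :=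
  ∀ p, φ (p + (2 * Real.pi, 0)) = φ p ∧ φ (p + (0, 2 * Real.pi)) = φ p

namespace DoublyPeriodic

/-- The closed square `[0, 2π]²`. -/
abbrev square : Set (ℝ × ℝ) :=
  Set.Icc (0 : ℝ) (2 * Real.pi) ×ˢ Set.Icc (0 : ℝ) (2 * Real.pi)

variable {α β γ : Type*}

theorem map {φ : ℝ × ℝ → α} (h : DoublyPeriodic φ) (g : α → β) :
    DoublyPeriodic (fun p => g (φ p)) :=
  fun p => ⟨congrArg g (h p).1, congrArg g (h p).2⟩

theorem map₂ {φ : ℝ × ℝ → α} {ψ : ℝ × ℝ → β} (h : DoublyPeriodic φ) (h' : DoublyPeriodic ψ)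
    (g : α → β → γ) : DoublyPeriodic (fun p => g (φ p) (ψ p)) :=
  fun p => ⟨congrArg₂ g (h p).1 (h' p).1, congrArg₂ g (h p).2 (h' p).2⟩

theorem partialDeriv {E : Type*} [NormedAddCommGroup E] [InnerProductSpace ℝ E]
    {X : ℝ × ℝ → E} (h : DoublyPeriodic X) (i : Fin 2) :
    DoublyPeriodic (WillmoreTorus.partialDeriv i X) := by
  intro p
  constructor <;> unfold WillmoreTorus.partialDeriv <;> rw [← fderiv_comp_add_right]
  · simp only [(h _).1]
  · simp only [(h _).2]

theorem exists_mem_square {φ : ℝ × ℝ → α} (h : DoublyPeriodic φ) (p : ℝ × ℝ) :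
    ∃ q ∈ square, φ q = φ p := by
  have hpi := Real.two_pi_pos
  have h1 (y : ℝ) : Function.Periodic (fun x => φ (x, y)) (2 * Real.pi) := fun x => by
    simpa using (h (x, y)).1
  have h2 (x : ℝ) : Function.Periodic (fun y => φ (x, y)) (2 * Real.pi) := fun y => by
    simpa using (h (x, y)).2
  obtain ⟨x, hx, hxe⟩ := (h1 p.2).exists_mem_Ico₀ hpi p.1
  obtain ⟨y, hy, hye⟩ := (h2 x).exists_mem_Ico₀ hpi p.2
  exact ⟨(x, y), ⟨Set.Ico_subset_Icc_self hx, Set.Ico_subset_Icc_self hy⟩,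
    hye.symm.trans hxe.symm⟩

theorem isCompact_square : IsCompact square := isCompact_Icc.prod isCompact_Icc

/-- A nonnegative continuous function on the torus with integral zero vanishes. -/
theorem eq_zero_of_integral_eq_zero {φ : ℝ × ℝ → ℝ} (h : DoublyPeriodic φ)
    (hc : Continuous φ) (h0 : ∀ p, 0 ≤ φ p) (hi : ∫ p in square, φ p = 0) (p : ℝ × ℝ) :
    φ p = 0 := by
  obtain ⟨q, hq, hqe⟩ := h.exists_mem_square p
  rw [← hqe]
  rw [MeasureTheory.setIntegral_eq_zero_iff_of_nonneg_ae (Filter.Eventually.of_forall h0)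
    (hc.continuousOn.integrableOn_compact isCompact_square)] at hi
  refine MeasureTheory.Measure.eqOn_of_ae_eq hi hc.continuousOn continuousOn_const ?_ hq
  rw [interior_prod_eq, interior_Icc, closure_prod_eq, closure_Ioo Real.two_pi_pos.ne]

theorem exists_isMax {φ : ℝ × ℝ → ℝ} (h : DoublyPeriodic φ) (hc : Continuous φ) :
    ∃ p, ∀ q, φ q ≤ φ p := by
  obtain ⟨p, -, hp⟩ := isCompact_square.exists_isMaxOn
    ⟨((0 : ℝ), (0 : ℝ)), by simp [Real.pi_nonneg]⟩ hc.continuousOn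
  refine ⟨p, fun q => ?_⟩
  obtain ⟨r, hr, hre⟩ := h.exists_mem_square q
  exact hre ▸ hp hr

/-- The divergence theorem on the torus. -/
theorem integral_divergence_eq_zero {P Q : ℝ × ℝ → ℝ} (hP : DoublyPeriodic P)
    (hQ : DoublyPeriodic Q) (hPs : ContDiff ℝ ∞ P) (hQs : ContDiff ℝ ∞ Q) :
    ∫ p in square, (WillmoreTorus.partialDeriv 0 Q p + WillmoreTorus.partialDeriv 1 P p) = 0 := by
  have hcont : Continuous
      fun p => WillmoreTorus.partialDeriv 0 Q p + WillmoreTorus.partialDeriv 1 P p :=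
    (contDiff_partialDeriv hQs 0).continuous.add (contDiff_partialDeriv hPs 1).continuous
  have h2 := MeasureTheory.integral2_divergence_prod_of_hasFDerivAt Q P (fderiv ℝ Q) (fderiv ℝ P)
    0 0 (2 * Real.pi) (2 * Real.pi) hQs.continuous.continuousOn hPs.continuous.continuousOn
    (fun x _ => (differentiable_of_smooth hQs x).hasFDerivAt)
    (fun x _ => (differentiable_of_smooth hPs x).hasFDerivAt)
    (hcont.continuousOn.integrableOn_compact (isCompact_uIcc.prod isCompact_uIcc))
  have hPp (x : ℝ) : P (x, 2 * Real.pi) = P (x, 0) := by simpa using (hP (x, 0)).2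
  have hQp (y : ℝ) : Q (2 * Real.pi, y) = Q (0, y) := by simpa using (hQ (0, y)).1
  simp only [hPp, hQp, sub_self, zero_add] at h2
  rw [square, MeasureTheory.Measure.volume_eq_prod, MeasureTheory.setIntegral_prod]
  · simp only [MeasureTheory.integral_Icc_eq_integral_Ioc]
    simp only [intervalIntegral.integral_of_le Real.two_pi_pos.le] at h2
    exact h2
  · exact hcont.continuousOn.integrableOn_compact isCompact_square

end DoublyPeriodic

/-! ### Vector algebra in three-space -/

/-- Euclidean three-space, which serves as the common model of all tangent spaces of the flat
manifold `ℝ² × S¹`. -/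
abbrev Space : Type := EuclideanSpace ℝ (Fin 3)

/-- The cross product on `Space` (Mathlib's `crossProduct` lives on `Fin 3 → ℝ`). -/
def cross (a b : Space) : Space :=
  !₂[a 1 * b 2 - a 2 * b 1, a 2 * b 0 - a 0 * b 2, a 0 * b 1 - a 1 * b 0]

theorem inner_space (a b : Space) : inner ℝ a b = a 0 * b 0 + a 1 * b 1 + a 2 * b 2 := by
  simp [PiLp.inner_apply, Fin.sum_univ_three, mul_comm]

theorem inner_four (a b : EuclideanSpace ℝ (Fin 4)) :
    inner ℝ a b = a 0 * b 0 + a 1 * b 1 + a 2 * b 2 + a 3 * b 3 := by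
  simp [PiLp.inner_apply, Fin.sum_univ_four, mul_comm]

theorem inner_cross_left (a b : Space) : inner ℝ a (cross a b) = 0 := by
  simp only [inner_space]; simp [cross]; ring

theorem inner_cross_right (a b : Space) : inner ℝ b (cross a b) = 0 := by
  simp only [inner_space]; simp [cross]; ring

theorem inner_cross_cross (a b : Space) :
    inner ℝ (cross a b) (cross a b)
      = inner ℝ a a * inner ℝ b b - inner ℝ a b * inner ℝ a b := by
  simp only [inner_space]; simp [cross]; ring

/-- The product of two triple products is a Gram determinant. -/
theorem inner_cross_mul_inner_cross (x y a b : Space) :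
    inner ℝ x (cross a b) * inner ℝ y (cross a b)
      = inner ℝ x y * (inner ℝ a a * inner ℝ b b - inner ℝ a b * inner ℝ a b)
        - inner ℝ x a * (inner ℝ a y * inner ℝ b b - inner ℝ a b * inner ℝ b y)
        + inner ℝ x b * (inner ℝ a y * inner ℝ a b - inner ℝ a a * inner ℝ b y) := by
  simp only [inner_space]; simp [cross]; ring

/-- A vector orthogonal to `a` and `b` is a multiple of `cross a b`. -/
theorem smul_eq_inner_cross_smul {x a b : Space} (ha : inner ℝ x a = 0) (hb : inner ℝ x b = 0) :
    inner ℝ (cross a b) (cross a b) • x = inner ℝ x (cross a b) • cross a b := by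
  rw [inner_space] at ha hb
  simp only [inner_space]
  ext k
  fin_cases k <;> simp [cross]
  · linear_combination (a 0 * (b 1 ^ 2 + b 2 ^ 2) - b 0 * (a 1 * b 1 + a 2 * b 2)) * ha
      + (b 0 * (a 1 ^ 2 + a 2 ^ 2) - a 0 * (a 1 * b 1 + a 2 * b 2)) * hb
  · linear_combination (a 1 * (b 0 ^ 2 + b 2 ^ 2) - b 1 * (a 0 * b 0 + a 2 * b 2)) * ha
      + (b 1 * (a 0 ^ 2 + a 2 ^ 2) - a 1 * (a 0 * b 0 + a 2 * b 2)) * hb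
  · linear_combination (a 2 * (b 0 ^ 2 + b 1 ^ 2) - b 2 * (a 0 * b 0 + a 1 * b 1)) * ha
      + (b 2 * (a 0 ^ 2 + a 1 ^ 2) - a 2 * (a 0 * b 0 + a 1 * b 1)) * hb

/-! ### The flat tangent frame of `ℝ² × S¹` -/

/-- The isometry of `Space` onto the tangent space of `ℝ² × S¹ ⊆ ℝ⁴` at `y`, given by the parallel
frame `(1, 0, 0, 0)`, `(0, 1, 0, 0)`, `(0, 0, -y₃, y₂)`. -/
def frame (y : EuclideanSpace ℝ (Fin 4)) (a : Space) : EuclideanSpace ℝ (Fin 4) :=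
  !₂[a 0, a 1, -(a 2 * y 3), a 2 * y 2]

theorem inner_frame {y : EuclideanSpace ℝ (Fin 4)} (hy : y 2 * y 2 + y 3 * y 3 = 1)
    (a b : Space) : inner ℝ (frame y a) (frame y b) = inner ℝ a b := by
  simp [inner_four, inner_space, frame]
  linear_combination a 2 * b 2 * hy

theorem mem_tangentAt {y v : EuclideanSpace ℝ (Fin 4)} :
    v ∈ tangentAt y ↔ y 2 * v 2 + y 3 * v 3 = 0 := by
  simp [tangentAt, Submodule.mem_orthogonal_singleton_iff_inner_right, inner_four]

theorem frame_mem_tangentAt (y : EuclideanSpace ℝ (Fin 4)) (a : Space) :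
    frame y a ∈ tangentAt y := by
  rw [mem_tangentAt]; simp [frame]; ring

/-- The coordinates of a vector of `ℝ⁴` in the parallel frame at `y`, after orthogonal projection
to the tangent space of `ℝ² × S¹`. -/
def coframe (y v : EuclideanSpace ℝ (Fin 4)) : Space :=
  !₂[v 0, v 1, y 2 * v 3 - y 3 * v 2]

theorem inner_coframe (y v : EuclideanSpace ℝ (Fin 4)) (a : Space) :
    inner ℝ (coframe y v) a = inner ℝ v (frame y a) := by
  simp [inner_four, inner_space, frame, coframe]; ring

theorem frame_coframe {y v : EuclideanSpace ℝ (Fin 4)} (hy : y 2 * y 2 + y 3 * y 3 = 1)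
    (hv : v ∈ tangentAt y) : frame y (coframe y v) = v := by
  rw [mem_tangentAt] at hv
  ext k
  fin_cases k <;> simp [frame, coframe]
  · linear_combination v 2 * hy - y 2 * hv
  · linear_combination v 3 * hy - y 3 * hv

/-- A regular parametrized torus in `ℝ² × S¹ ⊆ ℝ⁴`, given in angular coordinates. -/
structure IsTorusChart (X : ℝ × ℝ → EuclideanSpace ℝ (Fin 4)) : Prop where
  smooth : ContDiff ℝ ∞ X
  circle : ∀ p, X p 2 * X p 2 + X p 3 * X p 3 = 1
  periodic : DoublyPeriodic X
  injective : ∀ p, Function.Injective (fderiv ℝ X p)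

/-- The coordinate vector field `∂ᵢ X` in the parallel frame of `ℝ² × S¹`. -/
def flatDeriv (i : Fin 2) (X : ℝ × ℝ → EuclideanSpace ℝ (Fin 4)) (p : ℝ × ℝ) : Space :=
  coframe (X p) (partialDeriv i X p)

/-- The Gram determinant of `∂₁ X, ∂₂ X` is positive at an immersed point; the proof is the
Gram–Schmidt step for `∂₂ X`. -/
theorem firstForm_det_pos {E : Type*} [NormedAddCommGroup E] [InnerProductSpace ℝ E]
    [FiniteDimensional ℝ E] {X : ℝ × ℝ → E} {p : ℝ × ℝ}
    (h : Function.Injective (fderiv ℝ X p)) : 0 < (firstForm X p).det := by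
  have hinj (v : ℝ × ℝ) (hv : fderiv ℝ X p v = 0) : v = 0 :=
    h (hv.trans (map_zero _).symm)
  have hA : partialDeriv 0 X p ≠ 0 := fun h0 => by
    simpa [coordVec] using congrArg Prod.fst (hinj _ h0)
  set A := partialDeriv 0 X p with hAdef
  set B := partialDeriv 1 X p with hBdef
  have hlin (a b : ℝ) : fderiv ℝ X p (a, b) = a • A + b • B := by
    have : ((a, b) : ℝ × ℝ) = a • coordVec 0 + b • coordVec 1 := by
      ext <;> simp [coordVec]
    rw [this, map_add, map_smul, map_smul]; rfl
  have hE : 0 < inner ℝ A A := real_inner_self_pos.2 hA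
  have hw : inner ℝ A A • B - inner ℝ A B • A ≠ 0 := fun h0 => by
    have h1 := hinj (-inner ℝ A B, inner ℝ A A) (by rw [hlin, ← h0, neg_smul]; abel)
    exact hE.ne' (congrArg Prod.snd h1)
  have hpos := real_inner_self_pos.2 hw
  have hexp : inner ℝ (inner ℝ A A • B - inner ℝ A B • A) (inner ℝ A A • B - inner ℝ A B • A)
      = inner ℝ A A * (inner ℝ A A * inner ℝ B B - inner ℝ A B * inner ℝ A B) := by
    simp only [inner_sub_left, inner_sub_right, real_inner_smul_left, real_inner_smul_right,
      real_inner_comm A B]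
    ring
  rw [hexp] at hpos
  have := pos_of_mul_pos_right hpos hE.le
  simpa [firstForm, Matrix.det_fin_two, ← hAdef, ← hBdef, real_inner_comm A B] using this

namespace IsTorusChart

variable {X : ℝ × ℝ → EuclideanSpace ℝ (Fin 4)}

theorem partialDeriv_mem (hX : IsTorusChart X) (i : Fin 2) (p : ℝ × ℝ) :
    partialDeriv i X p ∈ tangentAt (X p) := by
  have h : partialDeriv i (fun q => X q 2 * X q 2 + X q 3 * X q 3) p = 0 := by
    rw [funext hX.circle, partialDeriv_const]
  have h2 := smooth_coord hX.smooth 2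
  have h3 := smooth_coord hX.smooth 3
  rw [partialDeriv_add (h2.mul h2) (h3.mul h3), partialDeriv_mul h2 h2, partialDeriv_mul h3 h3,
    ← partialDeriv_coord hX.smooth, ← partialDeriv_coord hX.smooth] at h
  rw [mem_tangentAt]
  linarith

theorem frame_flatDeriv (hX : IsTorusChart X) (i : Fin 2) (p : ℝ × ℝ) :
    frame (X p) (flatDeriv i X p) = partialDeriv i X p :=
  frame_coframe (hX.circle p) (hX.partialDeriv_mem i p)

theorem inner_flatDeriv (hX : IsTorusChart X) (i j : Fin 2) (p : ℝ × ℝ) :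
    inner ℝ (flatDeriv i X p) (flatDeriv j X p) = firstForm X p i j := by
  rw [← inner_frame (hX.circle p), hX.frame_flatDeriv, hX.frame_flatDeriv]
  rfl

theorem smooth_flatDeriv (hX : IsTorusChart X) (i : Fin 2) : ContDiff ℝ ∞ (flatDeriv i X) := by
  have h := smooth_coord (contDiff_partialDeriv hX.smooth i)
  have hs := smooth_coord hX.smooth
  rw [contDiff_euclidean]
  intro k
  fin_cases k
  · exact h 0
  · exact h 1
  · exact ((hs 2).mul (h 3)).sub ((hs 3).mul (h 2))

theorem periodic_flatDeriv (hX : IsTorusChart X) (i : Fin 2) :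
    DoublyPeriodic (flatDeriv i X) :=
  hX.periodic.map₂ (hX.periodic.partialDeriv i) coframe

/-- The frame is parallel: differentiating the coordinates of `∂ⱼ X` gives the coordinates of the
tangential part of `∂ᵢ ∂ⱼ X`. -/
theorem partialDeriv_flatDeriv (hX : IsTorusChart X) (i j : Fin 2) (p : ℝ × ℝ) :
    partialDeriv i (flatDeriv j X) p = coframe (X p) (partialDeriv i (partialDeriv j X) p) := by
  have hs := smooth_coord hX.smooth
  have hD := contDiff_partialDeriv hX.smooth j
  have h := smooth_coord hD
  have hi := mem_tangentAt.1 (hX.partialDeriv_mem i p)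
  have hj := mem_tangentAt.1 (hX.partialDeriv_mem j p)
  have hc := hX.circle p
  ext k
  rw [partialDeriv_coord (hX.smooth_flatDeriv j)]
  fin_cases k
  · exact (partialDeriv_coord hD i p 0).symm
  · exact (partialDeriv_coord hD i p 1).symm
  · change partialDeriv i (fun q => X q 2 * partialDeriv j X q 3 - X q 3 * partialDeriv j X q 2) p
      = X p 2 * partialDeriv i (partialDeriv j X) p 3
        - X p 3 * partialDeriv i (partialDeriv j X) p 2
    rw [partialDeriv_sub ((hs 2).mul (h 3)) ((hs 3).mul (h 2)), partialDeriv_mul (hs 2) (h 3),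
      partialDeriv_mul (hs 3) (h 2), ← partialDeriv_coord hX.smooth, ← partialDeriv_coord hX.smooth,
      ← partialDeriv_coord hD, ← partialDeriv_coord hD]
    -- `∂ᵢ(X₂, X₃)` and `∂ⱼ(X₂, X₃)` are both orthogonal to `(X₂, X₃)`, hence parallel.
    set a := partialDeriv i X p 2
    set b := partialDeriv i X p 3
    set c := partialDeriv j X p 2
    set d := partialDeriv j X p 3
    have hab : a * d - b * c = 0 := by
      linear_combination (-(a * d) + b * c) * hc + (X p 2 * d - X p 3 * c) * hi
        + (X p 3 * a - X p 2 * b) * hj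
    linear_combination hab

theorem partialDeriv_flatDeriv_comm (hX : IsTorusChart X) (p : ℝ × ℝ) :
    partialDeriv 1 (flatDeriv 0 X) p = partialDeriv 0 (flatDeriv 1 X) p := by
  rw [hX.partialDeriv_flatDeriv, hX.partialDeriv_flatDeriv, partialDeriv_comm hX.smooth]

end IsTorusChart

/-! ### The second fundamental form in coordinates -/

/-- The unnormalized normal field `∂₁ X × ∂₂ X` in the parallel frame. -/
def flatNormal (X : ℝ × ℝ → EuclideanSpace ℝ (Fin 4)) (p : ℝ × ℝ) : Space :=
  cross (flatDeriv 0 X p) (flatDeriv 1 X p)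

/-- The coefficients `⟨∂ᵢ ∂ⱼ X, ∂₁ X × ∂₂ X⟩` of the second fundamental form with respect to the
unnormalized normal field. -/
def normalCoeff (i j : Fin 2) (X : ℝ × ℝ → EuclideanSpace ℝ (Fin 4)) (p : ℝ × ℝ) : ℝ :=
  inner ℝ (partialDeriv i (flatDeriv j X) p) (flatNormal X p)

/-- The numerator `(g₂₂ L₁₁ - 2 g₁₂ L₁₂ + g₁₁ L₂₂)² - 4 det(g) det(L)` of `ρ²`, a discriminant in
the coefficients `L` of the second fundamental form. -/
def umbilicDefect (X : ℝ × ℝ → EuclideanSpace ℝ (Fin 4)) (p : ℝ × ℝ) : ℝ :=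
  (firstForm X p 1 1 * normalCoeff 0 0 X p - 2 * firstForm X p 0 1 * normalCoeff 0 1 X p
      + firstForm X p 0 0 * normalCoeff 1 1 X p) ^ 2
    - 4 * (firstForm X p).det
      * (normalCoeff 0 0 X p * normalCoeff 1 1 X p - normalCoeff 0 1 X p ^ 2)

namespace IsTorusChart

variable {X : ℝ × ℝ → EuclideanSpace ℝ (Fin 4)}

theorem firstForm_symm (p : ℝ × ℝ) : firstForm X p 1 0 = firstForm X p 0 1 :=
  real_inner_comm (partialDeriv 0 X p) (partialDeriv 1 X p)

theorem det_pos (hX : IsTorusChart X) (p : ℝ × ℝ) : 0 < (firstForm X p).det :=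
  firstForm_det_pos (hX.injective p)

theorem det_eq (p : ℝ × ℝ) : (firstForm X p).det
    = firstForm X p 0 0 * firstForm X p 1 1 - firstForm X p 0 1 * firstForm X p 0 1 := by
  rw [Matrix.det_fin_two, firstForm_symm]

theorem inner_flatNormal_self (hX : IsTorusChart X) (p : ℝ × ℝ) :
    inner ℝ (flatNormal X p) (flatNormal X p) = (firstForm X p).det := by
  rw [flatNormal, inner_cross_cross, hX.inner_flatDeriv, hX.inner_flatDeriv, hX.inner_flatDeriv,
    det_eq]

theorem normalCoeff_symm (hX : IsTorusChart X) (p : ℝ × ℝ) :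
    normalCoeff 1 0 X p = normalCoeff 0 1 X p := by
  rw [normalCoeff, hX.partialDeriv_flatDeriv_comm, normalCoeff]

theorem mem_normalSpace {p : ℝ × ℝ} {v : EuclideanSpace ℝ (Fin 4)} :
    v ∈ normalSpace tangentAt X p ↔
      v ∈ tangentAt (X p) ∧ ∀ i, inner ℝ (partialDeriv i X p) v = 0 := by
  rw [normalSpace, Submodule.mem_inf]
  refine and_congr_right fun _ => ?_
  rw [Submodule.mem_orthogonal]
  constructor
  · exact fun h i => h _ (Submodule.subset_span ⟨i, rfl⟩)
  · intro h u hu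
    induction hu using Submodule.span_induction with
    | mem x hx => obtain ⟨i, rfl⟩ := hx; exact h i
    | zero => simp
    | add x y _ _ hx hy => rw [inner_add_left, hx, hy, add_zero]
    | smul a x _ hx => rw [real_inner_smul_left, hx, mul_zero]

/-- The normal space is the line spanned by the normal field, which gives the projection in the
definition of the second fundamental form. -/
theorem secondForm_eq (hX : IsTorusChart X) (i j : Fin 2) (p : ℝ × ℝ) :
    secondForm tangentAt X p i j
      = (normalCoeff i j X p / (firstForm X p).det) • frame (X p) (flatNormal X p) := by
  have hc := hX.circle p
  have hpos := hX.det_pos p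
  apply Submodule.eq_starProjection_of_mem_of_inner_eq_zero
  · refine Submodule.smul_mem _ _ (mem_normalSpace.2 ⟨frame_mem_tangentAt _ _, fun k => ?_⟩)
    rw [← hX.frame_flatDeriv, inner_frame hc]
    fin_cases k
    · exact inner_cross_left _ _
    · exact inner_cross_right _ _
  · intro w hw
    obtain ⟨hwt, hwo⟩ := mem_normalSpace.1 hw
    obtain ⟨a, rfl⟩ : ∃ a, frame (X p) a = w := ⟨_, frame_coframe hc hwt⟩
    have ho (k : Fin 2) : inner ℝ a (flatDeriv k X p) = 0 := by
      rw [real_inner_comm, ← inner_frame hc, hX.frame_flatDeriv]; exact hwo k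
    have hcol := smul_eq_inner_cross_smul (ho 0) (ho 1)
    rw [← flatNormal, hX.inner_flatNormal_self] at hcol
    have hk : inner ℝ (partialDeriv i (partialDeriv j X) p) (frame (X p) a)
        = inner ℝ (partialDeriv i (flatDeriv j X) p) a := by
      rw [hX.partialDeriv_flatDeriv, inner_coframe]
    rw [inner_sub_left, real_inner_smul_left, inner_frame hc, hk, sub_eq_zero]
    have h1 := congrArg (inner ℝ (partialDeriv i (flatDeriv j X) p)) hcol
    rw [real_inner_smul_right, real_inner_smul_right] at h1
    rw [real_inner_comm a (flatNormal X p), normalCoeff]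
    field_simp
    linear_combination h1

theorem rhoSq_eq (hX : IsTorusChart X) (p : ℝ × ℝ) :
    rhoSq tangentAt X p = umbilicDefect X p / (2 * (firstForm X p).det ^ 3) := by
  have hc := hX.circle p
  have hpos := hX.det_pos p
  have hdet := det_eq (X := X) p
  have hinv : (firstForm X p)⁻¹ = ((firstForm X p).det)⁻¹ •
      !![firstForm X p 1 1, -firstForm X p 0 1; -firstForm X p 0 1, firstForm X p 0 0] := by
    rw [Matrix.inv_def, Matrix.adjugate_fin_two, firstForm_symm, Ring.inverse_eq_inv']
  have hnn : ‖frame (X p) (flatNormal X p)‖ ^ 2 = (firstForm X p).det := by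
    rw [← real_inner_self_eq_norm_sq, inner_frame hc, hX.inner_flatNormal_self]
  have hin : inner ℝ (frame (X p) (flatNormal X p)) (frame (X p) (flatNormal X p))
      = (firstForm X p).det := by
    rw [inner_frame hc, hX.inner_flatNormal_self]
  rw [rhoSq, secondFormNormSq, meanCurvature, umbilicDefect]
  simp only [hX.secondForm_eq, smul_smul, ← Finset.sum_smul, norm_smul, mul_pow, hnn,
    real_inner_smul_left, real_inner_smul_right, hin, Real.norm_eq_abs, sq_abs, hinv]
  simp only [Fin.sum_univ_two, Matrix.smul_apply, Matrix.of_apply, Matrix.cons_val',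
    Matrix.cons_val_zero, Matrix.cons_val_one, Matrix.cons_val_fin_one, smul_eq_mul,
    hX.normalCoeff_symm]
  generalize (firstForm X p).det = D at *
  field_simp
  subst hdet
  ring

/-- `g₁₁²` times the defect is a sum of two squares with positive weights, which vanish together
only where `L` is proportional to `g`. -/
theorem sq_mul_umbilicDefect (p : ℝ × ℝ) :
    firstForm X p 0 0 ^ 2 * umbilicDefect X p
      = (firstForm X p 0 0 * (firstForm X p 0 0 * normalCoeff 1 1 X p
            - firstForm X p 1 1 * normalCoeff 0 0 X p)
          - 2 * firstForm X p 0 1 * (firstForm X p 0 0 * normalCoeff 0 1 X p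
            - firstForm X p 0 1 * normalCoeff 0 0 X p)) ^ 2
        + 4 * (firstForm X p).det * (firstForm X p 0 0 * normalCoeff 0 1 X p
            - firstForm X p 0 1 * normalCoeff 0 0 X p) ^ 2 := by
  rw [umbilicDefect, det_eq]
  ring

theorem firstForm_pos (hX : IsTorusChart X) (p : ℝ × ℝ) : 0 < firstForm X p 0 0 := by
  have h0 : 0 ≤ firstForm X p 0 0 :=
    real_inner_self_nonneg (x := partialDeriv 0 X p)
  refine lt_of_le_of_ne h0 fun h => ?_
  have := hX.det_pos p
  rw [det_eq, ← h] at this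
  nlinarith [sq_nonneg (firstForm X p 0 1)]

theorem umbilicDefect_nonneg (hX : IsTorusChart X) (p : ℝ × ℝ) : 0 ≤ umbilicDefect X p := by
  have hE := hX.firstForm_pos p
  have hD := hX.det_pos p
  refine nonneg_of_mul_nonneg_right (a := firstForm X p 0 0 ^ 2) ?_ (by positivity)
  rw [sq_mul_umbilicDefect]
  positivity

/-- At an umbilic point `L` is proportional to `g`. -/
theorem smul_eq_of_umbilicDefect_eq_zero (hX : IsTorusChart X) {p : ℝ × ℝ}
    (h : umbilicDefect X p = 0) :
    firstForm X p 0 0 * normalCoeff 0 1 X p = firstForm X p 0 1 * normalCoeff 0 0 X p ∧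
      firstForm X p 0 0 * normalCoeff 1 1 X p = firstForm X p 1 1 * normalCoeff 0 0 X p := by
  have hE := hX.firstForm_pos p
  have hD := hX.det_pos p
  have hs := sq_mul_umbilicDefect (X := X) p
  rw [h, mul_zero] at hs
  set u := firstForm X p 0 0 * normalCoeff 0 1 X p - firstForm X p 0 1 * normalCoeff 0 0 X p
  set w := firstForm X p 0 0 * normalCoeff 1 1 X p - firstForm X p 1 1 * normalCoeff 0 0 X p
  have hu : u = 0 := by
    by_contra hne
    have : 0 < 4 * (firstForm X p).det * u ^ 2 := by positivity
    nlinarith [sq_nonneg (firstForm X p 0 0 * w - 2 * firstForm X p 0 1 * u)]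
  have hw : w = 0 := by
    rw [hu] at hs
    by_contra hne
    have : 0 < (firstForm X p 0 0 * w) ^ 2 := by positivity
    nlinarith
  exact ⟨sub_eq_zero.1 hu, sub_eq_zero.1 hw⟩

theorem continuous_firstForm (hX : IsTorusChart X) (i j : Fin 2) :
    Continuous fun p => firstForm X p i j :=
  (contDiff_partialDeriv hX.smooth i).continuous.inner
    (contDiff_partialDeriv hX.smooth j).continuous

theorem continuous_det (hX : IsTorusChart X) : Continuous fun p => (firstForm X p).det := by
  simp only [det_eq]
  have := hX.continuous_firstForm
  fun_prop

theorem smooth_flatNormal (hX : IsTorusChart X) : ContDiff ℝ ∞ (flatNormal X) := by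
  have h0 := smooth_coord (hX.smooth_flatDeriv 0)
  have h1 := smooth_coord (hX.smooth_flatDeriv 1)
  rw [contDiff_euclidean]
  intro k
  fin_cases k
  · exact ((h0 1).mul (h1 2)).sub ((h0 2).mul (h1 1))
  · exact ((h0 2).mul (h1 0)).sub ((h0 0).mul (h1 2))
  · exact ((h0 0).mul (h1 1)).sub ((h0 1).mul (h1 0))

theorem continuous_normalCoeff (hX : IsTorusChart X) (i j : Fin 2) :
    Continuous (normalCoeff i j X) :=
  (contDiff_partialDeriv (hX.smooth_flatDeriv j) i).continuous.inner hX.smooth_flatNormal.continuous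

theorem continuous_umbilicDefect (hX : IsTorusChart X) : Continuous (umbilicDefect X) := by
  have h1 := hX.continuous_firstForm
  have h2 := hX.continuous_normalCoeff
  have h3 := hX.continuous_det
  unfold umbilicDefect
  fun_prop

theorem periodic_firstForm (hX : IsTorusChart X) : DoublyPeriodic (firstForm X) := by
  have h := fun i => hX.periodic.partialDeriv i
  intro p
  constructor <;> ext i j
  · exact congrArg₂ (inner ℝ) (h i p).1 (h j p).1
  · exact congrArg₂ (inner ℝ) (h i p).2 (h j p).2

theorem periodic_flatNormal (hX : IsTorusChart X) : DoublyPeriodic (flatNormal X) :=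
  (hX.periodic_flatDeriv 0).map₂ (hX.periodic_flatDeriv 1) cross

theorem periodic_normalCoeff (hX : IsTorusChart X) (i j : Fin 2) :
    DoublyPeriodic (normalCoeff i j X) :=
  ((hX.periodic_flatDeriv j).partialDeriv i).map₂ hX.periodic_flatNormal (inner ℝ)

theorem periodic_umbilicDefect (hX : IsTorusChart X) : DoublyPeriodic (umbilicDefect X) := by
  intro p
  have h := fun i j => hX.periodic_normalCoeff i j p
  constructor
  · simp only [umbilicDefect, (hX.periodic_firstForm p).1, (h _ _).1]
  · simp only [umbilicDefect, (hX.periodic_firstForm p).2, (h _ _).2]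

/-- The Willmore energy of a chart vanishes only if every point is umbilic. -/
theorem umbilicDefect_eq_zero (hX : IsTorusChart X)
    (h : ∫ p in DoublyPeriodic.square, rhoSq tangentAt X p * areaDensity X p = 0) (p : ℝ × ℝ) :
    umbilicDefect X p = 0 := by
  have hpos := hX.det_pos
  have hden (p : ℝ × ℝ) : 0 < 2 * (firstForm X p).det ^ 3 := by
    have := hpos p; positivity
  simp only [hX.rhoSq_eq, areaDensity] at h
  have h0 := DoublyPeriodic.eq_zero_of_integral_eq_zero
    (φ := fun p => umbilicDefect X p / (2 * (firstForm X p).det ^ 3) * √(firstForm X p).det)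
    (hX.periodic_umbilicDefect.map₂ hX.periodic_firstForm
      fun a g => a / (2 * g.det ^ 3) * √g.det)
    ((hX.continuous_umbilicDefect.div (by have := hX.continuous_det; fun_prop)
      fun p => (hden p).ne').mul hX.continuous_det.sqrt)
    (fun p => mul_nonneg (div_nonneg (hX.umbilicDefect_nonneg p) (hden p).le) (Real.sqrt_nonneg _))
    h p
  simpa [(hpos p).ne', Real.sqrt_eq_zero', (hpos p).not_ge] using h0

theorem integral_nonneg (hX : IsTorusChart X) :
    0 ≤ ∫ p in DoublyPeriodic.square, rhoSq tangentAt X p * areaDensity X p := by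
  refine MeasureTheory.integral_nonneg fun p => mul_nonneg ?_ (Real.sqrt_nonneg _)
  have := hX.det_pos p
  have := hX.umbilicDefect_nonneg p
  rw [hX.rhoSq_eq]
  positivity

end IsTorusChart

/-! ### Gauss–Bonnet for the torus -/

theorem inner_partialDeriv_add_eq_zero {e e' : ℝ × ℝ → Space} {c : ℝ} (h : ContDiff ℝ ∞ e)
    (h' : ContDiff ℝ ∞ e') (hc : ∀ p, inner ℝ (e p) (e' p) = c) (i : Fin 2) (p : ℝ × ℝ) :
    inner ℝ (e p) (partialDeriv i e' p) + inner ℝ (partialDeriv i e p) (e' p) = 0 := by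
  rw [← partialDeriv_inner h h', funext hc, partialDeriv_const]

/-- The curl of the connection form `⟨d e₁, e₂⟩` of an orthonormal frame, by the Gauss equation. -/
theorem curl_connection {e₁ e₂ : ℝ × ℝ → Space} (h₁ : ContDiff ℝ ∞ e₁) (h₂ : ContDiff ℝ ∞ e₂)
    (h₁₁ : ∀ p, inner ℝ (e₁ p) (e₁ p) = 1) (h₂₂ : ∀ p, inner ℝ (e₂ p) (e₂ p) = 1)
    (h₁₂ : ∀ p, inner ℝ (e₁ p) (e₂ p) = 0) (p : ℝ × ℝ) :
    partialDeriv 1 (fun q => inner ℝ (partialDeriv 0 e₁ q) (e₂ q)) p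
        - partialDeriv 0 (fun q => inner ℝ (partialDeriv 1 e₁ q) (e₂ q)) p
      = inner ℝ (partialDeriv 0 e₁ p) (cross (e₁ p) (e₂ p))
          * inner ℝ (partialDeriv 1 e₂ p) (cross (e₁ p) (e₂ p))
        - inner ℝ (partialDeriv 1 e₁ p) (cross (e₁ p) (e₂ p))
          * inner ℝ (partialDeriv 0 e₂ p) (cross (e₁ p) (e₂ p)) := by
  have ha (i : Fin 2) : inner ℝ (partialDeriv i e₁ p) (e₁ p) = 0 := by
    have := inner_partialDeriv_add_eq_zero h₁ h₁ h₁₁ i p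
    rw [real_inner_comm] at this; linarith
  have hb (i : Fin 2) : inner ℝ (e₂ p) (partialDeriv i e₂ p) = 0 := by
    have := inner_partialDeriv_add_eq_zero h₂ h₂ h₂₂ i p
    rw [real_inner_comm (e₂ p)] at this; linarith
  rw [partialDeriv_inner (contDiff_partialDeriv h₁ 0) h₂,
    partialDeriv_inner (contDiff_partialDeriv h₁ 1) h₂, partialDeriv_comm h₁ 1 0,
    inner_cross_mul_inner_cross, inner_cross_mul_inner_cross]
  simp only [h₁₁, h₂₂, h₁₂, ha, hb]
  ring

/-- An orthonormal frame whose normal has no component along its derivatives has a constant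
normal. -/
theorem cross_eq_const {e₁ e₂ : ℝ × ℝ → Space} (h₁ : ContDiff ℝ ∞ e₁) (h₂ : ContDiff ℝ ∞ e₂)
    (h₁₁ : ∀ p, inner ℝ (e₁ p) (e₁ p) = 1) (h₂₂ : ∀ p, inner ℝ (e₂ p) (e₂ p) = 1)
    (h₁₂ : ∀ p, inner ℝ (e₁ p) (e₂ p) = 0)
    (hn₁ : ∀ i p, inner ℝ (partialDeriv i e₁ p) (cross (e₁ p) (e₂ p)) = 0)
    (hn₂ : ∀ i p, inner ℝ (partialDeriv i e₂ p) (cross (e₁ p) (e₂ p)) = 0) (p q : ℝ × ℝ) :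
    cross (e₁ p) (e₂ p) = cross (e₁ q) (e₂ q) := by
  have hm : ContDiff ℝ ∞ (fun p => cross (e₁ p) (e₂ p)) := by
    have ha := smooth_coord h₁
    have hb := smooth_coord h₂
    rw [contDiff_euclidean]
    intro k
    fin_cases k
    · exact ((ha 1).mul (hb 2)).sub ((ha 2).mul (hb 1))
    · exact ((ha 2).mul (hb 0)).sub ((ha 0).mul (hb 2))
    · exact ((ha 0).mul (hb 1)).sub ((ha 1).mul (hb 0))
  refine is_const_of_fderiv_eq_zero (differentiable_of_smooth hm)
    (fun r => fderiv_eq_zero_of_partialDeriv fun i => ?_) p q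
  have ha := inner_partialDeriv_add_eq_zero h₁ hm (fun p => inner_cross_left _ _) i r
  have hb := inner_partialDeriv_add_eq_zero h₂ hm (fun p => inner_cross_right _ _) i r
  have hc := inner_partialDeriv_add_eq_zero (c := 1) hm hm
    (fun p => by rw [inner_cross_cross, h₁₁, h₂₂, h₁₂]; norm_num) i r
  rw [hn₁, add_zero] at ha
  rw [hn₂, add_zero] at hb
  set x := partialDeriv i (fun p => cross (e₁ p) (e₂ p)) r
  rw [real_inner_comm x] at hc
  have hx : inner ℝ x (cross (e₁ r) (e₂ r)) = 0 := by linarith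
  have := inner_cross_mul_inner_cross x x (e₁ r) (e₂ r)
  rw [hx, h₁₁, h₂₂, h₁₂, ha, hb] at this
  rw [← inner_self_eq_zero (𝕜 := ℝ)]
  linarith

theorem cross_smul_left (a b : Space) (α β γ : ℝ) :
    cross (α • a) (β • a + γ • b) = (α * γ) • cross a b := by
  ext k
  fin_cases k <;> simp [cross] <;> ring

namespace IsTorusChart

variable {X : ℝ × ℝ → EuclideanSpace ℝ (Fin 4)}

theorem smooth_firstForm (hX : IsTorusChart X) (i j : Fin 2) :
    ContDiff ℝ ∞ fun p => firstForm X p i j :=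
  (contDiff_partialDeriv hX.smooth i).inner ℝ (contDiff_partialDeriv hX.smooth j)

theorem inner_partialDeriv_linearComb (hX : IsTorusChart X) {b c : ℝ × ℝ → ℝ}
    (hb : ContDiff ℝ ∞ b) (hc : ContDiff ℝ ∞ c) (i : Fin 2) (p : ℝ × ℝ) :
    inner ℝ (partialDeriv i (fun q => b q • flatDeriv 0 X q + c q • flatDeriv 1 X q) p)
        (flatNormal X p) = b p * normalCoeff i 0 X p + c p * normalCoeff i 1 X p := by
  have hA := hX.smooth_flatDeriv 0
  have hB := hX.smooth_flatDeriv 1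
  have hbA : ContDiff ℝ ∞ fun q => b q • flatDeriv 0 X q := hb.smul hA
  have hcB : ContDiff ℝ ∞ fun q => c q • flatDeriv 1 X q := hc.smul hB
  rw [partialDeriv_add hbA hcB, partialDeriv_smul hb hA, partialDeriv_smul hc hB]
  simp only [inner_add_left, real_inner_smul_left]
  rw [show inner ℝ (flatDeriv 0 X p) (flatNormal X p) = 0 from inner_cross_left _ _,
    show inner ℝ (flatDeriv 1 X p) (flatNormal X p) = 0 from inner_cross_right _ _]
  simp [normalCoeff]

/-- The Gram–Schmidt frame of `∂₁ X, ∂₂ X`. It is globally defined on the torus, which is what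
distinguishes the torus from the sphere here. -/
theorem exists_orthonormal_frame (hX : IsTorusChart X) : ∃ α β γ : ℝ × ℝ → ℝ,
    ContDiff ℝ ∞ α ∧ ContDiff ℝ ∞ β ∧ ContDiff ℝ ∞ γ ∧
    DoublyPeriodic α ∧ DoublyPeriodic β ∧ DoublyPeriodic γ ∧
    (∀ p, 0 < α p) ∧ (∀ p, 0 < γ p) ∧
    (∀ p, inner ℝ (α p • flatDeriv 0 X p) (α p • flatDeriv 0 X p) = 1) ∧
    (∀ p, inner ℝ (β p • flatDeriv 0 X p + γ p • flatDeriv 1 X p)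
      (β p • flatDeriv 0 X p + γ p • flatDeriv 1 X p) = 1) ∧
    (∀ p, inner ℝ (α p • flatDeriv 0 X p)
      (β p • flatDeriv 0 X p + γ p • flatDeriv 1 X p) = 0) := by
  have hE := hX.firstForm_pos
  have hD := hX.det_pos
  have hs (p) : 0 < √(firstForm X p 0 0) := Real.sqrt_pos.2 (hE p)
  have hd (p) : 0 < √(firstForm X p).det := Real.sqrt_pos.2 (hD p)
  have hss : ContDiff ℝ ∞ fun p => √(firstForm X p 0 0) :=
    (hX.smooth_firstForm 0 0).sqrt fun p => (hE p).ne'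
  have hds : ContDiff ℝ ∞ fun p => √(firstForm X p).det := by
    refine ContDiff.sqrt ?_ fun p => (hD p).ne'
    simp only [det_eq]
    exact ((hX.smooth_firstForm 0 0).mul (hX.smooth_firstForm 1 1)).sub
      ((hX.smooth_firstForm 0 1).mul (hX.smooth_firstForm 0 1))
  have hg := hX.periodic_firstForm
  refine ⟨fun p => 1 / √(firstForm X p 0 0),
    fun p => -firstForm X p 0 1 / (√(firstForm X p 0 0) * √(firstForm X p).det),
    fun p => √(firstForm X p 0 0) / √(firstForm X p).det,
    contDiff_const.div hss fun p => (hs p).ne',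
    (hX.smooth_firstForm 0 1).neg.div (hss.mul hds) fun p => (mul_pos (hs p) (hd p)).ne',
    hss.div hds fun p => (hd p).ne',
    hg.map fun g => 1 / √(g 0 0), hg.map fun g => -g 0 1 / (√(g 0 0) * √g.det),
    hg.map fun g => √(g 0 0) / √g.det,
    fun p => one_div_pos.2 (hs p), fun p => div_pos (hs p) (hd p), ?_, ?_, ?_⟩
  all_goals
    intro p
    have h1 := Real.sq_sqrt (hE p).le
    have h2 := Real.sq_sqrt (hD p).le
    have h3 := hs p
    have h4 := hd p
    have h5 := det_eq (X := X) p
    simp only [inner_add_left, inner_add_right, real_inner_smul_left, real_inner_smul_right,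
      hX.inner_flatDeriv, firstForm_symm]
    generalize √(firstForm X p 0 0) = s at *
    generalize √(firstForm X p).det = d at *
    rw [← h2, ← h1] at h5
    rw [← h1]
    field_simp
  · linear_combination -h5
  · ring

/-- **Gauss–Bonnet for umbilic tori.** In an umbilic torus the extrinsic curvature is
nonnegative, and its total is zero, as the tangent bundle of the torus is trivial. -/
theorem normalCoeff_eq_zero (hX : IsTorusChart X) (h : ∀ p, umbilicDefect X p = 0) (i j : Fin 2)
    (p : ℝ × ℝ) : normalCoeff i j X p = 0 := by
  obtain ⟨α, β, γ, hα, hβ, hγ, pα, pβ, pγ, α0, γ0, h₁₁, h₂₂, h₁₂⟩ := hX.exists_orthonormal_frame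
  have hA := hX.smooth_flatDeriv 0
  have hB := hX.smooth_flatDeriv 1
  set e₁ : ℝ × ℝ → Space := fun p => α p • flatDeriv 0 X p with he₁
  set e₂ : ℝ × ℝ → Space := fun p => β p • flatDeriv 0 X p + γ p • flatDeriv 1 X p with he₂
  have h₁ : ContDiff ℝ ∞ e₁ := hα.smul hA
  have h₂ : ContDiff ℝ ∞ e₂ := (hβ.smul hA).add (hγ.smul hB)
  have p₁ : DoublyPeriodic e₁ := pα.map₂ (hX.periodic_flatDeriv 0) (· • ·)
  have p₂ : DoublyPeriodic e₂ := (pβ.map₂ (hX.periodic_flatDeriv 0) (· • ·)).map₂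
    (pγ.map₂ (hX.periodic_flatDeriv 1) (· • ·)) (· + ·)
  have hcross (p) : cross (e₁ p) (e₂ p) = (α p * γ p) • flatNormal X p := cross_smul_left _ _ _ _ _
  have hN₁ (i p) : inner ℝ (partialDeriv i e₁ p) (flatNormal X p) = α p * normalCoeff i 0 X p := by
    simpa [he₁] using hX.inner_partialDeriv_linearComb hα contDiff_const (c := fun _ => 0) i p
  have hN₂ (i p) : inner ℝ (partialDeriv i e₂ p) (flatNormal X p)
      = β p * normalCoeff i 0 X p + γ p * normalCoeff i 1 X p :=
    hX.inner_partialDeriv_linearComb hβ hγ i p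
  let P : ℝ × ℝ → ℝ := fun q => inner ℝ (partialDeriv 0 e₁ q) (e₂ q)
  let Q : ℝ × ℝ → ℝ := fun q => -inner ℝ (partialDeriv 1 e₁ q) (e₂ q)
  have hP : ContDiff ℝ ∞ P := (contDiff_partialDeriv h₁ 0).inner ℝ h₂
  have hQ' : ContDiff ℝ ∞ (fun q => inner ℝ (partialDeriv 1 e₁ q) (e₂ q)) :=
    (contDiff_partialDeriv h₁ 1).inner ℝ h₂
  have hQ : ContDiff ℝ ∞ Q := hQ'.neg
  have pP : DoublyPeriodic P := (p₁.partialDeriv 0).map₂ p₂ (inner ℝ)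
  have pQ : DoublyPeriodic Q := (p₁.partialDeriv 1).map₂ p₂ fun a b => -inner ℝ a b
  -- In the umbilic case `det L = (L₁₁ / g₁₁)² det g`.
  have hcurl (p) : partialDeriv 0 Q p + partialDeriv 1 P p
      = (α p * γ p) ^ 3 *
        ((normalCoeff 0 0 X p / firstForm X p 0 0) ^ 2 * (firstForm X p).det) := by
    have hc := curl_connection h₁ h₂ h₁₁ h₂₂ h₁₂ p
    have hneg : partialDeriv 0 Q p
        = -partialDeriv 0 (fun q => inner ℝ (partialDeriv 1 e₁ q) (e₂ q)) p := by
      simp only [partialDeriv, Q, fderiv_fun_neg]; rfl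
    rw [hcross] at hc
    simp only [real_inner_smul_right, hN₁, hN₂, hX.normalCoeff_symm] at hc
    obtain ⟨hM, hN⟩ := hX.smul_eq_of_umbilicDefect_eq_zero (h p)
    have hE := hX.firstForm_pos p
    have hM' : normalCoeff 0 1 X p
        = firstForm X p 0 1 * normalCoeff 0 0 X p / firstForm X p 0 0 := by
      field_simp; linear_combination hM
    have hN' : normalCoeff 1 1 X p
        = firstForm X p 1 1 * normalCoeff 0 0 X p / firstForm X p 0 0 := by
      field_simp; linear_combination hN
    rw [hneg, neg_add_eq_sub]
    refine hc.trans ?_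
    rw [hM', hN', det_eq]
    field_simp
    ring
  have hpos (p) : 0 < (α p * γ p) ^ 3 := pow_pos (mul_pos (α0 p) (γ0 p)) 3
  have hzero (p) : normalCoeff 0 0 X p = 0 := by
    have hz := DoublyPeriodic.eq_zero_of_integral_eq_zero
      ((pQ.partialDeriv 0).map₂ (pP.partialDeriv 1) (· + ·))
      ((contDiff_partialDeriv hQ 0).continuous.add (contDiff_partialDeriv hP 1).continuous)
      (fun p => by
        simp only [hcurl]
        have := hX.det_pos p
        have := hpos p
        positivity)
      (DoublyPeriodic.integral_divergence_eq_zero pP pQ hP hQ) p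
    simpa [hcurl, (α0 p).ne', (γ0 p).ne', (hX.det_pos p).ne', (hX.firstForm_pos p).ne'] using hz
  obtain ⟨hM, hN⟩ := hX.smul_eq_of_umbilicDefect_eq_zero (h p)
  rw [hzero, mul_zero] at hM hN
  have hE := (hX.firstForm_pos p).ne'
  have hM' := (mul_eq_zero.1 hM).resolve_left hE
  have hN' := (mul_eq_zero.1 hN).resolve_left hE
  fin_cases i <;> fin_cases j
  · exact hzero p
  · exact hM'
  · exact (hX.normalCoeff_symm p).trans hM'
  · exact hN'

/-! ### There is no totally geodesic torus -/

/-- An immersed torus is not totally geodesic: its normal would be constant, and a horizontal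
linear function orthogonal to it would have no critical point on the surface. -/
theorem exists_normalCoeff_ne_zero (hX : IsTorusChart X) :
    ∃ i j p, normalCoeff i j X p ≠ 0 := by
  by_contra! h
  obtain ⟨α, β, γ, hα, hβ, hγ, -, -, -, α0, γ0, h₁₁, h₂₂, h₁₂⟩ := hX.exists_orthonormal_frame
  have hA := hX.smooth_flatDeriv 0
  have hB := hX.smooth_flatDeriv 1
  set e₁ : ℝ × ℝ → Space := fun p => α p • flatDeriv 0 X p with he₁
  set e₂ : ℝ × ℝ → Space := fun p => β p • flatDeriv 0 X p + γ p • flatDeriv 1 X p with he₂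
  have hcross (p) : cross (e₁ p) (e₂ p) = (α p * γ p) • flatNormal X p := cross_smul_left _ _ _ _ _
  have h₁ : ContDiff ℝ ∞ e₁ := hα.smul hA
  have h₂ : ContDiff ℝ ∞ e₂ := (hβ.smul hA).add (hγ.smul hB)
  have hconst := cross_eq_const h₁ h₂ h₁₁ h₂₂ h₁₂
    (fun i p => by
      have := hX.inner_partialDeriv_linearComb hα contDiff_const (c := fun _ => 0) i p
      simp only [zero_smul, add_zero, h, mul_zero] at this
      exact (congrArg (inner ℝ _) (hcross p)).trans
        (by rw [real_inner_smul_right, he₁, this, mul_zero]))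
    (fun i p => by
      have := hX.inner_partialDeriv_linearComb hβ hγ i p
      simp only [add_zero, h, mul_zero] at this
      exact (congrArg (inner ℝ _) (hcross p)).trans
        (by rw [real_inner_smul_right, he₂, this, mul_zero]))
  set m := cross (e₁ 0) (e₂ 0) with hm
  -- A nonzero horizontal vector orthogonal to the constant normal `m`.
  obtain ⟨w, hw0, hw2, hwm⟩ : ∃ w : Space, w ≠ 0 ∧ w 2 = 0 ∧ inner ℝ w m = 0 := by
    by_cases hm0 : m 0 = 0 ∧ m 1 = 0
    · exact ⟨!₂[1, 0, 0], fun h0 => by simpa using congrArg (fun v : Space => v 0) h0, by simp,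
        by simp [inner_space, hm0.1]⟩
    · refine ⟨!₂[-m 1, m 0, 0], fun h0 => hm0 ⟨?_, ?_⟩, by simp, by simp [inner_space]; ring⟩
      · simpa using congrArg (fun v : Space => v 1) h0
      · simpa using congrArg (fun v : Space => v 0) h0
  have hs := smooth_coord hX.smooth
  have hφs : ContDiff ℝ ∞ fun q => w 0 * X q 0 + w 1 * X q 1 :=
    (contDiff_const.mul (hs 0)).add (contDiff_const.mul (hs 1))
  obtain ⟨p, hp⟩ := DoublyPeriodic.exists_isMax
    (hX.periodic.map fun x => w 0 * x 0 + w 1 * x 1) hφs.continuous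
  have hcrit : fderiv ℝ (fun q => w 0 * X q 0 + w 1 * X q 1) p = 0 :=
    IsLocalMax.fderiv_eq_zero (Filter.Eventually.of_forall hp)
  have horth (i : Fin 2) : inner ℝ w (flatDeriv i X p) = 0 := by
    have h0 : partialDeriv i (fun q => w 0 * X q 0 + w 1 * X q 1) p = 0 := by
      rw [partialDeriv, hcrit]; rfl
    rw [partialDeriv_add (contDiff_const.mul (hs 0)) (contDiff_const.mul (hs 1)),
      partialDeriv_mul contDiff_const (hs 0), partialDeriv_mul contDiff_const (hs 1),
      partialDeriv_const, partialDeriv_const, ← partialDeriv_coord hX.smooth,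
      ← partialDeriv_coord hX.smooth] at h0
    rw [inner_space, hw2]
    simp only [flatDeriv, coframe]
    simpa using h0
  have hcol := smul_eq_inner_cross_smul (horth 0) (horth 1)
  have hwn : inner ℝ w (flatNormal X p) = 0 := by
    have h1 : inner ℝ w (cross (e₁ p) (e₂ p)) = 0 := by
      rw [← hwm, hm]
      exact congrArg _ (hconst p 0)
    rw [hcross, real_inner_smul_right] at h1
    exact (mul_eq_zero.1 h1).resolve_left (mul_pos (α0 p) (γ0 p)).ne'
  rw [← flatNormal, hX.inner_flatNormal_self, hwn, zero_smul] at hcol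
  exact hw0 ((smul_eq_zero.1 hcol).resolve_left (hX.det_pos p).ne')

theorem integral_pos (hX : IsTorusChart X) :
    0 < ∫ p in DoublyPeriodic.square, rhoSq tangentAt X p * areaDensity X p := by
  refine hX.integral_nonneg.lt_of_ne fun h => ?_
  obtain ⟨i, j, p, hne⟩ := hX.exists_normalCoeff_ne_zero
  exact hne (hX.normalCoeff_eq_zero (hX.umbilicDefect_eq_zero h.symm) i j p)

end IsTorusChart

/-! ### Immersions of the abstract torus -/

attribute [local instance] finrank_real_complex_fact'

theorem contMDiff_circle_coe : ContMDiff (𝓡 1) 𝓘(ℝ, ℂ) ∞ (fun z : Circle => (z : ℂ)) :=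
  contMDiff_coe_sphere

theorem mfderiv_circle_coe_injective (z : Circle) :
    Function.Injective (mfderiv (𝓡 1) 𝓘(ℝ, ℂ) (fun z : Circle => (z : ℂ)) z) :=
  injective_mvfderiv_subtypeVal_sphere (E := ℂ) (n := 1) z

section Kernel

variable {E₁ E₂ E₃ H₁ H₂ H₃ M₁ M₂ M₃ : Type*}
  [NormedAddCommGroup E₁] [NormedSpace ℝ E₁] [TopologicalSpace H₁]
  [NormedAddCommGroup E₂] [NormedSpace ℝ E₂] [TopologicalSpace H₂]
  [NormedAddCommGroup E₃] [NormedSpace ℝ E₃] [TopologicalSpace H₃]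
  {I₁ : ModelWithCorners ℝ E₁ H₁} {I₂ : ModelWithCorners ℝ E₂ H₂} {I₃ : ModelWithCorners ℝ E₃ H₃}
  [TopologicalSpace M₁] [ChartedSpace H₁ M₁] [TopologicalSpace M₂] [ChartedSpace H₂ M₂]
  [TopologicalSpace M₃] [ChartedSpace H₃ M₃]

/-- The kernel of a differential grows under composition; used in the contrapositive, with a
convenient `g`, to prove that `f` is an immersion. -/
theorem mfderiv_comp_eq_zero {g : M₂ → M₃} {f : M₁ → M₂} {x : M₁}
    (hg : ContMDiff I₂ I₃ ∞ g) (hf : ContMDiff I₁ I₂ ∞ f) {v : TangentSpace I₁ x}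
    (hv : mfderiv I₁ I₂ f x v = 0) : mfderiv I₁ I₃ (g ∘ f) x v = 0 := by
  rw [mfderiv_comp x (hg.mdifferentiable (by simp) _) (hf.mdifferentiable (by simp) _)]
  change mfderiv I₂ I₃ g (f x) (mfderiv I₁ I₂ f x v) = 0
  rw [hv, map_zero]

end Kernel

/-- A linear isomorphism of `ℝ² × ℂ` onto `ℝ⁴`. -/
def planeComplexToFour : (Plane × ℂ) →L[ℝ] EuclideanSpace ℝ (Fin 4) :=
  LinearMap.toContinuousLinearMap
    { toFun := fun x => !₂[x.1 0, x.1 1, x.2.re, x.2.im]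
      map_add' := fun x y => by ext k; fin_cases k <;> simp
      map_smul' := fun c x => by ext k; fin_cases k <;> simp }

theorem planeComplexToFour_injective : Function.Injective planeComplexToFour := by
  intro x y h
  have h' (k : Fin 4) := congrArg (fun v : EuclideanSpace ℝ (Fin 4) => v k) h
  refine Prod.ext ?_ (Complex.ext ?_ ?_)
  · ext k
    fin_cases k
    · exact h' 0
    · exact h' 1
  · exact h' 2
  · exact h' 3

theorem contMDiff_incl :
    ContMDiff (𝓘(ℝ, Plane).prod (𝓡 1)) 𝓘(ℝ, EuclideanSpace ℝ (Fin 4)) ∞ incl := by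
  have h : ContMDiff (𝓘(ℝ, Plane).prod (𝓡 1)) 𝓘(ℝ, Plane × ℂ) ∞
      (fun y : PlaneCircle => (y.1, (y.2 : ℂ))) :=
    contMDiff_fst.prodMk_space (contMDiff_circle_coe.comp contMDiff_snd)
  exact planeComplexToFour.contDiff.contMDiff.comp h

/-- A tangent vector of a product with a circle whose image under the projection to `ℂ` vanishes
has no circle component. -/
theorem snd_eq_zero_of_mfderiv {E H M : Type*} [NormedAddCommGroup E] [NormedSpace ℝ E]
    [TopologicalSpace H] {I : ModelWithCorners ℝ E H} [TopologicalSpace M] [ChartedSpace H M]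
    {y : M × Circle} {v : TangentSpace (I.prod (𝓡 1)) y}
    (h : mfderiv (I.prod (𝓡 1)) 𝓘(ℝ, ℂ) (fun y : M × Circle => (y.2 : ℂ)) y v = 0) :
    (show E × EuclideanSpace ℝ (Fin 1) from v).2 = 0 := by
  apply mfderiv_circle_coe_injective y.2
  rw [show (fun y : M × Circle => (y.2 : ℂ)) = (fun z : Circle => (z : ℂ)) ∘ Prod.snd from rfl,
    mfderiv_comp y (contMDiff_circle_coe.mdifferentiable (by simp) _)
      mdifferentiableAt_snd, mfderiv_snd] at h
  exact h.trans (map_zero _).symm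

theorem fst_eq_zero_of_mfderiv {E H M : Type*} [NormedAddCommGroup E] [NormedSpace ℝ E]
    [TopologicalSpace H] {I : ModelWithCorners ℝ E H} [TopologicalSpace M] [ChartedSpace H M]
    {y : Circle × M} {v : TangentSpace ((𝓡 1).prod I) y}
    (h : mfderiv ((𝓡 1).prod I) 𝓘(ℝ, ℂ) (fun y : Circle × M => (y.1 : ℂ)) y v = 0) :
    (show EuclideanSpace ℝ (Fin 1) × E from v).1 = 0 := by
  apply mfderiv_circle_coe_injective y.1
  rw [show (fun y : Circle × M => (y.1 : ℂ)) = (fun z : Circle => (z : ℂ)) ∘ Prod.fst from rfl,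
    mfderiv_comp y (contMDiff_circle_coe.mdifferentiable (by simp) _)
      mdifferentiableAt_fst, mfderiv_fst] at h
  exact h.trans (map_zero _).symm

theorem mfderiv_incl_injective (y : PlaneCircle) : Function.Injective
    (mfderiv (𝓘(ℝ, Plane).prod (𝓡 1)) 𝓘(ℝ, EuclideanSpace ℝ (Fin 4)) incl y) := by
  rw [injective_iff_map_eq_zero]
  intro v hv
  obtain ⟨L₀, hL⟩ := planeComplexToFour.exists_leftInverse_of_injective
    (LinearMap.ker_eq_bot.2 planeComplexToFour_injective)
  let L := LinearMap.toContinuousLinearMap L₀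
  have hLa (x) : L (planeComplexToFour x) = x := congrArg (fun g => g x) hL
  have h1 := mfderiv_comp_eq_zero
    ((ContinuousLinearMap.fst ℝ Plane ℂ ∘L L).contDiff (n := ∞)).contMDiff contMDiff_incl hv
  have h2 := mfderiv_comp_eq_zero
    ((ContinuousLinearMap.snd ℝ Plane ℂ ∘L L).contDiff (n := ∞)).contMDiff contMDiff_incl hv
  rw [show ⇑(ContinuousLinearMap.fst ℝ Plane ℂ ∘L L) ∘ incl = Prod.fst from
    funext fun y => congrArg Prod.fst (hLa (y.1, (y.2 : ℂ))), mfderiv_fst] at h1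
  rw [show ⇑(ContinuousLinearMap.snd ℝ Plane ℂ ∘L L) ∘ incl = fun y => (y.2 : ℂ) from
    funext fun y => congrArg Prod.snd (hLa (y.1, (y.2 : ℂ)))] at h2
  exact Prod.ext h1 (snd_eq_zero_of_mfderiv h2)

/-- The angular coordinates of the torus. -/
def angular (p : ℝ × ℝ) : Torus := (Circle.exp p.1, Circle.exp p.2)

theorem contMDiff_angular : ContMDiff 𝓘(ℝ, ℝ × ℝ) ((𝓡 1).prod (𝓡 1)) ∞ angular :=
  (contMDiff_circleExp.comp contDiff_fst.contMDiff).prodMk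
    (contMDiff_circleExp.comp contDiff_snd.contMDiff)

theorem mfderiv_angular_injective (p : ℝ × ℝ) :
    Function.Injective (mfderiv 𝓘(ℝ, ℝ × ℝ) ((𝓡 1).prod (𝓡 1)) angular p) := by
  rw [injective_iff_map_eq_zero]
  intro v hv
  have key (l : (ℝ × ℝ) →L[ℝ] ℝ) (w : ℝ × ℝ)
      (h : fderiv ℝ (fun q => (Circle.exp (l q) : ℂ)) p w = 0) : l w = 0 := by
    have hd : HasFDerivAt (fun q : ℝ × ℝ => (Circle.exp (l q) : ℂ)) _ p :=
      (((Complex.ofRealCLM ∘L l).hasFDerivAt (x := p)).mul_const Complex.I).cexp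
    rw [hd.fderiv] at h
    simpa using h
  have h1 := mfderiv_comp_eq_zero (contMDiff_circle_coe.comp contMDiff_fst) contMDiff_angular hv
  have h2 := mfderiv_comp_eq_zero (contMDiff_circle_coe.comp contMDiff_snd) contMDiff_angular hv
  rw [mfderiv_eq_fderiv] at h1 h2
  exact Prod.ext (key (ContinuousLinearMap.fst ℝ ℝ ℝ) v h1)
    (key (ContinuousLinearMap.snd ℝ ℝ ℝ) v h2)

theorem IsImmersedTorus.isTorusChart {f : Torus → PlaneCircle} (hf : IsImmersedTorus f) :
    IsTorusChart (lift f) where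
  smooth := (contMDiff_incl.comp (hf.1.comp contMDiff_angular)).contDiff
  circle p := by
    have h := Circle.normSq_coe (f (Circle.exp p.1, Circle.exp p.2)).2
    rw [Complex.normSq_apply] at h
    exact h
  periodic p := by
    constructor <;> simp [lift]
  injective p := by
    rw [← mfderiv_eq_fderiv]
    have hF : lift f = incl ∘ f ∘ angular := rfl
    have h1 := hf.1.mdifferentiable (by simp) (angular p)
    have h2 := contMDiff_angular.mdifferentiable (by simp) p
    have h3 := contMDiff_incl.mdifferentiable (by simp) (f (angular p))
    rw [hF, mfderiv_comp p h3 (h1.comp p h2), mfderiv_comp p h1 h2]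
    exact (mfderiv_incl_injective _).comp ((hf.2 _).comp (mfderiv_angular_injective p))

theorem willmore_pos {f : Torus → PlaneCircle} (hf : IsImmersedTorus f) : 0 < willmore f :=
  mul_pos (by norm_num) hf.isTorusChart.integral_pos

/-! ### The flat cylindrical tori -/

/-- The identification of `ℂ` with the plane, scaled by `t`. -/
def complexToPlane (t : ℝ) : ℂ →L[ℝ] Plane :=
  LinearMap.toContinuousLinearMap
    { toFun := fun z => !₂[t * z.re, t * z.im]
      map_add' := fun x y => by ext k; fin_cases k <;> simp [mul_add]
      map_smul' := fun c x => by ext k; fin_cases k <;> simp <;> ring }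

theorem isImmersedTorus_cylinderTorus {t : ℝ} (ht : 0 < t) :
    IsImmersedTorus (cylinderTorus t) := by
  have hinj : Function.Injective (complexToPlane t) := by
    intro x y h
    have h0 : t * x.re = t * y.re := congrArg (fun v : Plane => v 0) h
    have h1 : t * x.im = t * y.im := congrArg (fun v : Plane => v 1) h
    exact Complex.ext (mul_left_cancel₀ ht.ne' h0) (mul_left_cancel₀ ht.ne' h1)
  have hsmooth : ContMDiff ((𝓡 1).prod (𝓡 1)) (𝓘(ℝ, Plane).prod (𝓡 1)) ∞ (cylinderTorus t) :=
    ((complexToPlane t).contDiff.contMDiff.comp (contMDiff_circle_coe.comp contMDiff_fst)).prodMk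
      contMDiff_snd
  refine ⟨hsmooth, fun p => ?_⟩
  rw [injective_iff_map_eq_zero]
  intro v hv
  obtain ⟨L₀, hL⟩ := (complexToPlane t).exists_leftInverse_of_injective
    (LinearMap.ker_eq_bot.2 hinj)
  let L := LinearMap.toContinuousLinearMap L₀
  have hLa (x) : L (complexToPlane t x) = x := congrArg (fun g => g x) hL
  have h1 := mfderiv_comp_eq_zero ((L.contDiff (n := ∞)).contMDiff.comp contMDiff_fst) hsmooth hv
  have h2 := mfderiv_comp_eq_zero (contMDiff_circle_coe.comp contMDiff_snd) hsmooth hv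
  rw [show (L ∘ Prod.fst) ∘ cylinderTorus t = fun y => (y.1 : ℂ) from
    funext fun y => hLa (y.1 : ℂ)] at h1
  exact Prod.ext (fst_eq_zero_of_mfderiv h1) (snd_eq_zero_of_mfderiv h2)

theorem partialDeriv_comp_fst {g : ℝ → ℝ} {g' : ℝ} {p : ℝ × ℝ} (h : HasDerivAt g g' p.1)
    (i : Fin 2) : partialDeriv i (fun q => g q.1) p = g' * (coordVec i).1 := by
  have := (h.comp_hasFDerivAt p (ContinuousLinearMap.fst ℝ ℝ ℝ).hasFDerivAt).fderiv
  rw [partialDeriv, show (fun q : ℝ × ℝ => g q.1) = g ∘ Prod.fst from rfl, this]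
  simp

theorem partialDeriv_comp_snd {g : ℝ → ℝ} {g' : ℝ} {p : ℝ × ℝ} (h : HasDerivAt g g' p.2)
    (i : Fin 2) : partialDeriv i (fun q => g q.2) p = g' * (coordVec i).2 := by
  have := (h.comp_hasFDerivAt p (ContinuousLinearMap.snd ℝ ℝ ℝ).hasFDerivAt).fderiv
  rw [partialDeriv, show (fun q : ℝ × ℝ => g q.2) = g ∘ Prod.snd from rfl, this]
  simp

theorem lift_cylinderTorus (t : ℝ) (p : ℝ × ℝ) : lift (cylinderTorus t) p
    = !₂[t * Real.cos p.1, t * Real.sin p.1, Real.cos p.2, Real.sin p.2] := by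
  simp [lift, incl, cylinderTorus, Circle.coe_exp, Complex.exp_ofReal_mul_I_re,
    Complex.exp_ofReal_mul_I_im]

theorem flatDeriv_cylinderTorus {t : ℝ} (ht : 0 < t) (i : Fin 2) (p : ℝ × ℝ) :
    flatDeriv i (lift (cylinderTorus t)) p
      = !₂[-(t * Real.sin p.1) * (coordVec i).1, t * Real.cos p.1 * (coordVec i).1,
          (coordVec i).2] := by
  have hs := (isImmersedTorus_cylinderTorus ht).isTorusChart.smooth
  have h0 := partialDeriv_comp_fst (p := p) ((Real.hasDerivAt_cos p.1).const_mul t) i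
  have h1 := partialDeriv_comp_fst (p := p) ((Real.hasDerivAt_sin p.1).const_mul t) i
  have h2 := partialDeriv_comp_snd (p := p) (Real.hasDerivAt_cos p.2) i
  have h3 := partialDeriv_comp_snd (p := p) (Real.hasDerivAt_sin p.2) i
  ext k
  simp only [flatDeriv, coframe, partialDeriv_coord hs]
  simp only [lift_cylinderTorus]
  fin_cases k <;> simp [h0, h1, h2, h3]
  linear_combination (coordVec i).2 * Real.sin_sq_add_cos_sq p.2

theorem rhoSq_mul_areaDensity_cylinderTorus {t : ℝ} (ht : 0 < t) (p : ℝ × ℝ) :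
    rhoSq tangentAt (lift (cylinderTorus t)) p * areaDensity (lift (cylinderTorus t)) p
      = 1 / (2 * t) := by
  have hX := (isImmersedTorus_cylinderTorus ht).isTorusChart
  set X := lift (cylinderTorus t) with hXd
  have hsc := Real.sin_sq_add_cos_sq p.1
  have hD (i) := fun p => flatDeriv_cylinderTorus ht i p
  have hE : firstForm X p 0 0 = t ^ 2 := by
    rw [← hX.inner_flatDeriv, hD, inner_space]
    simp [coordVec]
    linear_combination t ^ 2 * hsc
  have hF : firstForm X p 0 1 = 0 := by
    rw [← hX.inner_flatDeriv, hD, hD, inner_space]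
    simp [coordVec]
  have hG : firstForm X p 1 1 = 1 := by
    rw [← hX.inner_flatDeriv, hD, inner_space]
    simp [coordVec]
  have hdet : (firstForm X p).det = t ^ 2 := by
    rw [IsTorusChart.det_eq, hE, hF, hG]; ring
  have h1 : flatDeriv 1 X = fun _ => !₂[0, 0, 1] := by
    funext q; rw [hD]; simp [coordVec]
  have hN (i) : normalCoeff i 1 X p = 0 := by
    rw [normalCoeff, h1, partialDeriv_const, inner_zero_left]
  have h0 : flatDeriv 0 X = fun q => !₂[-(t * Real.sin q.1), t * Real.cos q.1, 0] := by
    funext q; rw [hD]; simp [coordVec]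
  have hL : normalCoeff 0 0 X p = -t ^ 2 := by
    have hs := partialDeriv_comp_fst (p := p) ((Real.hasDerivAt_sin p.1).const_mul t).fun_neg 0
    have hc := partialDeriv_comp_fst (p := p) ((Real.hasDerivAt_cos p.1).const_mul t) 0
    have hz := partialDeriv_const (0 : ℝ) 0 p
    rw [normalCoeff, inner_space, flatNormal]
    simp only [partialDeriv_coord (hX.smooth_flatDeriv 0)]
    simp only [h0, h1, cross]
    simp [hs, hc, hz, coordVec]
    linear_combination -t ^ 2 * hsc
  rw [hX.rhoSq_eq, areaDensity, umbilicDefect, hE, hF, hG, hdet, hN, hN, hL,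
    Real.sqrt_sq ht.le]
  field_simp
  ring

theorem willmore_cylinderTorus {t : ℝ} (ht : 0 < t) :
    willmore (cylinderTorus t) = Real.pi ^ 2 / t := by
  rw [willmore]
  simp only [rhoSq_mul_areaDensity_cylinderTorus ht]
  rw [MeasureTheory.setIntegral_const, MeasureTheory.Measure.volume_eq_prod,
    MeasureTheory.measureReal_prod_prod, Real.volume_real_Icc_of_le Real.two_pi_pos.le, smul_eq_mul]
  field_simp
  ring

end WillmoreTorus

end

theorem theorem4p4 :
    (∀ f : WillmoreTorus.Torus → WillmoreTorus.PlaneCircle,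
      WillmoreTorus.IsImmersedTorus f → 0 < WillmoreTorus.willmore f) ∧
    (∀ t : ℝ, 0 < t →
      WillmoreTorus.IsImmersedTorus (WillmoreTorus.cylinderTorus t) ∧
      WillmoreTorus.willmore (WillmoreTorus.cylinderTorus t) = Real.pi ^ 2 / t) ∧
    Filter.Tendsto (fun t : ℝ => WillmoreTorus.willmore (WillmoreTorus.cylinderTorus t))
      Filter.atTop (nhds 0) ∧
    ¬ ∃ f : WillmoreTorus.Torus → WillmoreTorus.PlaneCircle,
      WillmoreTorus.IsImmersedTorus f ∧
      ∀ f' : WillmoreTorus.Torus → WillmoreTorus.PlaneCircle,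
        WillmoreTorus.IsImmersedTorus f' →
          WillmoreTorus.willmore f ≤ WillmoreTorus.willmore f' := by
  have htend : Filter.Tendsto
      (fun t : ℝ => WillmoreTorus.willmore (WillmoreTorus.cylinderTorus t))
      Filter.atTop (nhds 0) := by
    refine (tendsto_const_nhds (x := Real.pi ^ 2).div_atTop Filter.tendsto_id).congr' ?_
    filter_upwards [Filter.eventually_gt_atTop 0] with t ht
    exact (WillmoreTorus.willmore_cylinderTorus ht).symm
  refine ⟨fun f hf => WillmoreTorus.willmore_pos hf, fun t ht =>
    ⟨WillmoreTorus.isImmersedTorus_cylinderTorus ht, WillmoreTorus.willmore_cylinderTorus ht⟩,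
    htend, ?_⟩
  rintro ⟨f, hf, hmin⟩
  obtain ⟨t, hlt, ht⟩ := ((htend.eventually_lt_const (WillmoreTorus.willmore_pos hf)).and
    (Filter.eventually_gt_atTop 0)).exists
  exact (hmin _ (WillmoreTorus.isImmersedTorus_cylinderTorus ht)).not_gt hlt
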